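/- For positive integers $m,n$ let $K_{1,m}\square K_{1,n}$ be the Cartesian product of the stars with $m$ and $n$ leaves. A set $W$ of vertices of a finite graph $G$ is a resolving set if any two distinct vertices $x\neq y$ of $G$ satisfy $d(x,w)\neq d(y,w)$ for some $w\in W$; the metric dimension $\dim(G)$ is the minimum cardinality of a resolving set. Theorem. Let $n\ge 2$ and $\frac n2\le m\le n$. Then $$\dim(K_{1,m}\square K_{1,n}) = n+\left\lfloor\frac{2m-n}{3}\right\rfloor.$$ -/

import Mathlib

namespace SimpleGraph

/-- A finite set `W` of vertices is a resolving set of `G` if vertices with the same distances to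
all members of `W` are equal. -/
def IsResolvingSet {V : Type*} (G : SimpleGraph V) (W : Finset V) : Prop :=
  ∀ x y : V, (∀ w ∈ W, G.edist x w = G.edist y w) → x = y

theorem isResolvingSet_univ {V : Type*} [Fintype V] (G : SimpleGraph V) :
    G.IsResolvingSet Finset.univ := by
  intro x y h
  have hy := h y (Finset.mem_univ y)
  rw [SimpleGraph.edist_self] at hy
  exact SimpleGraph.edist_eq_zero_iff.mp hy

/-- The metric dimension of a finite graph: the minimum cardinality of a resolving set. -/
noncomputable def metricDim {V : Type*} [Fintype V] (G : SimpleGraph V) : ℕ :=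
  sInf {k : ℕ | ∃ W : Finset V, G.IsResolvingSet W ∧ W.card = k}

/-- The minimum is attained, on every finite graph. -/
theorem isLeast_metricDim {V : Type*} [Fintype V] (G : SimpleGraph V) :
    IsLeast {k : ℕ | ∃ W : Finset V, G.IsResolvingSet W ∧ W.card = k} G.metricDim :=
  ⟨Nat.sInf_mem ⟨_, Finset.univ, G.isResolvingSet_univ, rfl⟩, fun _ hk => Nat.sInf_le hk⟩

/-- The star `K_{1,n}` with `n` leaves. -/
abbrev star (n : ℕ) : SimpleGraph (Fin 1 ⊕ Fin n) :=
  completeBipartiteGraph (Fin 1) (Fin n)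

end SimpleGraph

/-!
A vertex of `K_{1,m} □ K_{1,n}` is a pair of star vertices. Call the leaves of the two factors *rows*
and *columns*, and say that `w` touches row `i` if `w.1 = inr i` and column `j` if `w.2 = inr j`.
A set `W` of vertices is thus a bipartite graph on rows and columns: a pair of leaves is an edge, and
a pair of a leaf and a centre is a loop at that leaf. How the distances from two vertices to `w` compare
depends only on the lines that `w` touches (`starDist_inr`). So `W` is resolving if at most one row and
at most one column are untouched and, for each row `i` and column `j`, some member of `W` touches
exactly one of them and some member touches both or neither (`isResolvingSet_of_touch`). The lower
bound needs only that all but the last of these conditions are necessary.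

*Lower bound.* Two untouched lines are never allowed, nor is a component that is a single edge. Let an
edge or loop give `2` to a line that it alone touches and `1` to any other line that it touches. Every
touched line receives at least `2`, and every member of `W` gives at most `3`, because an edge giving
`2` to both ends would be an isolated edge. Hence `2 (m + n - 1) ≤ 3 |W|`
(`IsResolvingSet.two_mul_le_three_mul_card`).

*Upper bound.* Two edges forming a path on three lines attain the ratio `2 / 3`. A disjoint union of
such paths, with at most one loop and at most one untouched line, has `⌊2 (m + n) / 3⌋` members; the
numbers of paths centred at rows and at columns are forced, and they are nonnegative exactly because
`n / 2 ≤ m ≤ n`. This set is resolving except when `m = n = 3`, where one path centred at a row `i` and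
one centred at a column `j` leave `(i, j)` and the centre unresolved; there two loops replace a path
(`exists_isResolvingSet_card_le`).
-/

namespace SimpleGraph

/-! ### Distances in stars and their products -/

/-- The distance in the star with `n` leaves, as a natural number. -/
def starDist {n : ℕ} : Fin 1 ⊕ Fin n → Fin 1 ⊕ Fin n → ℕ
  | .inl _, .inl _ => 0
  | .inl _, .inr _ => 1
  | .inr _, .inl _ => 1
  | .inr i, .inr j => if i = j then 0 else 2

theorem edist_star {n : ℕ} (x y : Fin 1 ⊕ Fin n) : (star n).edist x y = starDist x y := by
  rcases x with a | i <;> rcases y with b | j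
  · simp [starDist, Subsingleton.elim a b]
  · simp [starDist, edist_eq_one_iff_adj]
  · simp [starDist, edist_eq_one_iff_adj]
  · by_cases h : i = j
    · simp [starDist, h]
    · have h2 : (star n).edist (.inr i) (.inr j) = 2 := by
        rw [edist_eq_two_iff]
        refine ⟨by simpa using h, by simp, ⟨.inl 0, ?_⟩⟩
        simp [mem_commonNeighbors]
      simp [starDist, h, h2]

/-- The distance from a leaf `j` is determined by the distance from the centre and by whether the
other end is `j`. -/
theorem starDist_inr {n : ℕ} (a : Fin 1) (j : Fin n) (b : Fin 1 ⊕ Fin n) :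
    starDist (.inr j) b + (if b = .inr j then 2 else 0) = starDist (.inl a) b + 1 := by
  rcases b with b | b
  · simp [starDist]
  · by_cases h : j = b
    · simp [starDist, h]
    · simp [starDist, h, Ne.symm h]

theorem edist_boxProd_star_eq_iff {m n : ℕ} (x y w : (Fin 1 ⊕ Fin m) × (Fin 1 ⊕ Fin n)) :
    ((star m).boxProd (star n)).edist x w = ((star m).boxProd (star n)).edist y w ↔
      starDist x.1 w.1 + starDist x.2 w.2 = starDist y.1 w.1 + starDist y.2 w.2 := by
  simp only [edist_boxProd, edist_star]
  norm_cast

/-- The parity of a distance depends only on the numbers of leaves among the coordinates. -/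
theorem even_starDist {n : ℕ} (x y : Fin 1 ⊕ Fin n) :
    Even (starDist x y) ↔ (x.isLeft ↔ y.isLeft) := by
  rcases x with x | x <;> rcases y with y | y <;> simp [starDist]
  split_ifs <;> simp

/-! ### Resolving sets in terms of touched lines -/

section Resolving

variable {m n : ℕ} {W : Finset ((Fin 1 ⊕ Fin m) × (Fin 1 ⊕ Fin n))}

theorem IsResolvingSet.row_unique (hW : ((star m).boxProd (star n)).IsResolvingSet W)
    {i i' : Fin m} (h : ∀ w ∈ W, w.1 ≠ .inr i) (h' : ∀ w ∈ W, w.1 ≠ .inr i') : i = i' := by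
  have := hW (.inr i, .inl 0) (.inr i', .inl 0) fun w hw => by
    rw [edist_boxProd_star_eq_iff]
    have h1 := starDist_inr 0 i w.1
    have h2 := starDist_inr 0 i' w.1
    rw [if_neg (h w hw)] at h1
    rw [if_neg (h' w hw)] at h2
    dsimp only
    omega
  simpa using this

theorem IsResolvingSet.column_unique (hW : ((star m).boxProd (star n)).IsResolvingSet W)
    {j j' : Fin n} (h : ∀ w ∈ W, w.2 ≠ .inr j) (h' : ∀ w ∈ W, w.2 ≠ .inr j') : j = j' := by
  have := hW (.inl 0, .inr j) (.inl 0, .inr j') fun w hw => by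
    rw [edist_boxProd_star_eq_iff]
    have h1 := starDist_inr 0 j w.2
    have h2 := starDist_inr 0 j' w.2
    rw [if_neg (h w hw)] at h1
    rw [if_neg (h' w hw)] at h2
    dsimp only
    omega
  simpa using this

/-- Otherwise `(i, centre)` and `(centre, j)` are unresolved. -/
theorem IsResolvingSet.exists_touch_one (hW : ((star m).boxProd (star n)).IsResolvingSet W)
    (i : Fin m) (j : Fin n) : ∃ w ∈ W, ¬(w.1 = .inr i ↔ w.2 = .inr j) := by
  by_contra! h
  have := hW (.inr i, .inl 0) (.inl 0, .inr j) fun w hw => by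
    rw [edist_boxProd_star_eq_iff]
    have h1 := starDist_inr 0 i w.1
    have h2 := starDist_inr 0 j w.2
    simp only [h w hw] at h1
    dsimp only
    omega
  simp at this

/-- The four conditions resolve, in turn, two rows (or two leaf pairs in one column), two columns (or
two leaf pairs in one row), a row from a column (or two leaf pairs differing in both coordinates),
and a leaf pair from the centre. All other pairs of vertices are resolved by parity. -/
theorem isResolvingSet_of_touch (hm : 0 < m) (hn : 0 < n)
    (hrow : ∀ i i' : Fin m, i ≠ i' → ∃ w ∈ W, w.1 = .inr i ∨ w.1 = .inr i')
    (hcol : ∀ j j' : Fin n, j ≠ j' → ∃ w ∈ W, w.2 = .inr j ∨ w.2 = .inr j')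
    (hone : ∀ (i : Fin m) (j : Fin n), ∃ w ∈ W, ¬(w.1 = .inr i ↔ w.2 = .inr j))
    (hiff : ∀ (i : Fin m) (j : Fin n), ∃ w ∈ W, (w.1 = .inr i ↔ w.2 = .inr j)) :
    ((star m).boxProd (star n)).IsResolvingSet W := by
  intro x y h
  simp only [edist_boxProd_star_eq_iff] at h
  have hpar : (x.1.isLeft ↔ x.2.isLeft) ↔ (y.1.isLeft ↔ y.2.isLeft) := by
    obtain ⟨w, hw, -⟩ := hone ⟨0, hm⟩ ⟨0, hn⟩
    have := congrArg Even (h w hw)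
    simp only [Nat.even_add, even_starDist, eq_iff_iff] at this
    revert this
    generalize x.1.isLeft = a, x.2.isLeft = b, y.1.isLeft = c, y.2.isLeft = d,
      w.1.isLeft = e, w.2.isLeft = f
    revert a b c d e f
    decide
  have centre_leaf : ∀ (a b : Fin 1) (i : Fin m) (j : Fin n),
      ¬∀ w ∈ W, starDist (.inl a) w.1 + starDist (.inl b) w.2 =
        starDist (.inr i) w.1 + starDist (.inr j) w.2 := by
    intro a b i j H
    obtain ⟨w, hw, hij⟩ := hiff i j
    have h0 := H w hw
    have h1 := starDist_inr a i w.1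
    have h2 := starDist_inr b j w.2
    simp only [hij] at h1
    split_ifs at h1 h2 <;> omega
  have row_column : ∀ (a b : Fin 1) (i : Fin m) (j : Fin n),
      ¬∀ w ∈ W, starDist (.inr i) w.1 + starDist (.inl b) w.2 =
        starDist (.inl a) w.1 + starDist (.inr j) w.2 := by
    intro a b i j H
    obtain ⟨w, hw, hij⟩ := hone i j
    have h0 := H w hw
    have h1 := starDist_inr a i w.1
    have h2 := starDist_inr b j w.2
    split_ifs at h1 h2 <;> first | omega | tauto
  have rows : ∀ (z : Fin 1 ⊕ Fin n) (i i' : Fin m),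
      (∀ w ∈ W, starDist (.inr i) w.1 + starDist z w.2 = starDist (.inr i') w.1 + starDist z w.2) →
        i = i' := by
    intro z i i' H
    by_contra hne
    obtain ⟨w, hw, hii⟩ := hrow i i' hne
    have h0 := H w hw
    have h1 := starDist_inr 0 i w.1
    have h2 := starDist_inr 0 i' w.1
    split_ifs at h1 h2 with e e' e'
    · exact hne (Sum.inr_injective (e.symm.trans e'))
    · omega
    · omega
    · tauto
  have columns : ∀ (z : Fin 1 ⊕ Fin m) (j j' : Fin n),
      (∀ w ∈ W, starDist z w.1 + starDist (.inr j) w.2 = starDist z w.1 + starDist (.inr j') w.2) →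
        j = j' := by
    intro z j j' H
    by_contra hne
    obtain ⟨w, hw, hjj⟩ := hcol j j' hne
    have h0 := H w hw
    have h1 := starDist_inr 0 j w.2
    have h2 := starDist_inr 0 j' w.2
    split_ifs at h1 h2 with e e' e'
    · exact hne (Sum.inr_injective (e.symm.trans e'))
    · omega
    · omega
    · tauto
  obtain ⟨a | i, b | j⟩ := x <;> obtain ⟨a' | i', b' | j'⟩ := y <;> simp at hpar <;>
    dsimp only at h
  · rw [Subsingleton.elim a a', Subsingleton.elim b b']
  · exact (centre_leaf _ _ _ _ h).elim
  · rw [Subsingleton.elim a a'] at h ⊢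
    rw [columns _ _ _ h]
  · exact (row_column _ _ _ _ fun w hw => (h w hw).symm).elim
  · exact (row_column _ _ _ _ h).elim
  · rw [Subsingleton.elim b b'] at h ⊢
    rw [rows _ _ _ h]
  · exact (centre_leaf _ _ _ _ fun w hw => (h w hw).symm).elim
  · by_cases hi : i = i'
    · subst hi
      rw [columns _ _ _ h]
    by_cases hj : j = j'
    · subst hj
      rw [rows _ _ _ h]
    -- A member touching exactly one of row `i` and column `j'` is nearer to one of the two pairs.
    obtain ⟨w, hw, hij⟩ := hone i j'
    have h0 := h w hw
    have h1 := starDist_inr 0 i w.1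
    have h2 := starDist_inr 0 i' w.1
    have h3 := starDist_inr 0 j w.2
    have h4 := starDist_inr 0 j' w.2
    have hii : ¬(w.1 = .inr i ∧ w.1 = .inr i') := fun e =>
      hi (Sum.inr_injective (e.1.symm.trans e.2))
    have hjj : ¬(w.2 = .inr j ∧ w.2 = .inr j') := fun e =>
      hj (Sum.inr_injective (e.1.symm.trans e.2))
    split_ifs at h1 h2 h3 h4 <;> first | omega | tauto

end Resolving

/-! ### The lower bound -/

/-- The charge that `w` gives to a line touched by exactly the members of `S`. -/
def charge {α : Type*} [DecidableEq α] (S : Finset α) (w : α) : ℕ :=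
  if w ∈ S then (if S.card = 1 then 2 else 1) else 0

theorem two_le_sum_charge {α : Type*} [DecidableEq α] {S W : Finset α} (hS : S.Nonempty)
    (hSW : S ⊆ W) : 2 ≤ ∑ w ∈ W, charge S w := by
  have hsum : ∑ w ∈ W, charge S w = S.card * (if S.card = 1 then 2 else 1) := by
    simp only [charge, Finset.sum_ite_mem, Finset.inter_eq_right.mpr hSW, Finset.sum_const,
      smul_eq_mul]
  have := hS.card_pos
  rw [hsum]
  split_ifs <;> omega

/-- The members of `W` touching a given row (`inl i`) or column (`inr j`). -/
def touching {m n : ℕ} (W : Finset ((Fin 1 ⊕ Fin m) × (Fin 1 ⊕ Fin n))) :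
    Fin m ⊕ Fin n → Finset ((Fin 1 ⊕ Fin m) × (Fin 1 ⊕ Fin n))
  | .inl i => W.filter fun w => w.1 = .inr i
  | .inr j => W.filter fun w => w.2 = .inr j

theorem touching_subset {m n : ℕ} (W : Finset ((Fin 1 ⊕ Fin m) × (Fin 1 ⊕ Fin n)))
    (v : Fin m ⊕ Fin n) : touching W v ⊆ W := by
  rcases v with i | j <;> exact Finset.filter_subset _ _

section LowerBound

variable {m n : ℕ} {W : Finset ((Fin 1 ⊕ Fin m) × (Fin 1 ⊕ Fin n))}

theorem IsResolvingSet.touching_inl_ne (hW : ((star m).boxProd (star n)).IsResolvingSet W)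
    (i : Fin m) (j : Fin n) : touching W (.inl i) ≠ touching W (.inr j) := by
  intro h
  obtain ⟨w, hw, hij⟩ := hW.exists_touch_one i j
  have := Finset.ext_iff.mp h w
  simp only [touching, Finset.mem_filter, hw, true_and] at this
  exact hij this

/-- At most one line is untouched. -/
theorem IsResolvingSet.eq_of_touching_eq_empty
    (hW : ((star m).boxProd (star n)).IsResolvingSet W) {u v : Fin m ⊕ Fin n}
    (hu : touching W u = ∅) (hv : touching W v = ∅) : u = v := by
  rcases u with i | j <;> rcases v with i' | j'
  · simp only [touching, Finset.filter_eq_empty_iff] at hu hv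
    rw [hW.row_unique (fun w hw => hu hw) (fun w hw => hv hw)]
  · exact (hW.touching_inl_ne i j' (hu.trans hv.symm)).elim
  · exact (hW.touching_inl_ne i' j (hv.trans hu.symm)).elim
  · simp only [touching, Finset.filter_eq_empty_iff] at hu hv
    rw [hW.column_unique (fun w hw => hu hw) (fun w hw => hv hw)]

theorem charge_touching_inl_eq_zero {w : (Fin 1 ⊕ Fin m) × (Fin 1 ⊕ Fin n)} {i : Fin m}
    (h : w.1 ≠ .inr i) : charge (touching W (.inl i)) w = 0 := by
  simp [charge, touching, h]

theorem charge_touching_inr_eq_zero {w : (Fin 1 ⊕ Fin m) × (Fin 1 ⊕ Fin n)} {j : Fin n}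
    (h : w.2 ≠ .inr j) : charge (touching W (.inr j)) w = 0 := by
  simp [charge, touching, h]

theorem charge_le_two {α : Type*} [DecidableEq α] (S : Finset α) (w : α) : charge S w ≤ 2 := by
  unfold charge
  split_ifs <;> omega

theorem eq_singleton_of_one_lt_charge {α : Type*} [DecidableEq α] {S : Finset α} {w : α}
    (h : 1 < charge S w) : S = {w} := by
  unfold charge at h
  split_ifs at h with h1 h2
  · obtain ⟨a, rfl⟩ := Finset.card_eq_one.mp h2
    rw [Finset.mem_singleton.mp h1]
  · omega
  · omega

/-- A member giving `2` to both of its lines would be an isolated edge. -/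
theorem IsResolvingSet.sum_charge_le_three (hW : ((star m).boxProd (star n)).IsResolvingSet W)
    (w : (Fin 1 ⊕ Fin m) × (Fin 1 ⊕ Fin n)) : ∑ v, charge (touching W v) w ≤ 3 := by
  rw [Fintype.sum_sum_type]
  have hrow : ∀ i, w.1 = .inr i →
      ∑ i, charge (touching W (.inl i)) w = charge (touching W (.inl i)) w := fun i hi =>
    Fintype.sum_eq_single i fun i' hne =>
      charge_touching_inl_eq_zero (by rw [hi]; exact fun e => hne (Sum.inr_injective e).symm)
  have hcol : ∀ j, w.2 = .inr j →
      ∑ j, charge (touching W (.inr j)) w = charge (touching W (.inr j)) w := fun j hj =>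
    Fintype.sum_eq_single j fun j' hne =>
      charge_touching_inr_eq_zero (by rw [hj]; exact fun e => hne (Sum.inr_injective e).symm)
  have hrow0 : ∀ a, w.1 = .inl a → ∑ i, charge (touching W (.inl i)) w = 0 := fun a ha =>
    Finset.sum_eq_zero fun i _ => charge_touching_inl_eq_zero (by simp [ha])
  have hcol0 : ∀ a, w.2 = .inl a → ∑ j, charge (touching W (.inr j)) w = 0 := fun a ha =>
    Finset.sum_eq_zero fun j _ => charge_touching_inr_eq_zero (by simp [ha])
  rcases h1 : w.1 with a | i <;> rcases h2 : w.2 with b | j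
  · rw [hrow0 a h1, hcol0 b h2]
    omega
  · rw [hrow0 a h1, hcol j h2]
    have := charge_le_two (touching W (.inr j)) w
    omega
  · rw [hrow i h1, hcol0 b h2]
    have := charge_le_two (touching W (.inl i)) w
    omega
  · rw [hrow i h1, hcol j h2]
    by_contra! h
    have hi := charge_le_two (touching W (.inl i)) w
    have hj := charge_le_two (touching W (.inr j)) w
    refine hW.touching_inl_ne i j ?_
    rw [eq_singleton_of_one_lt_charge (S := touching W (.inl i)) (w := w) (by omega),
      eq_singleton_of_one_lt_charge (S := touching W (.inr j)) (w := w) (by omega)]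

theorem IsResolvingSet.two_mul_le_three_mul_card
    (hW : ((star m).boxProd (star n)).IsResolvingSet W) : 2 * (m + n - 1) ≤ 3 * W.card := by
  have hupper : ∑ v, ∑ w ∈ W, charge (touching W v) w ≤ 3 * W.card := by
    rw [Finset.sum_comm, mul_comm]
    exact Finset.sum_le_card_nsmul _ _ _ fun w _ => hW.sum_charge_le_three w
  have hlines : ∃ L : Finset (Fin m ⊕ Fin n), m + n - 1 ≤ L.card ∧
      ∀ v ∈ L, (touching W v).Nonempty := by
    by_cases h : ∃ v, touching W v = ∅
    · obtain ⟨v, hv⟩ := h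
      refine ⟨Finset.univ.erase v, by simp [Finset.card_erase_of_mem], fun u hu => ?_⟩
      rw [Finset.nonempty_iff_ne_empty]
      exact fun hu0 => Finset.ne_of_mem_erase hu (hW.eq_of_touching_eq_empty hu0 hv)
    · push Not at h
      exact ⟨Finset.univ, by simp, fun v _ => h v⟩
  obtain ⟨L, hL, hne⟩ := hlines
  have hlower : L.card * 2 ≤ ∑ v ∈ L, ∑ w ∈ W, charge (touching W v) w :=
    Finset.card_nsmul_le_sum _ _ _ fun v hv => two_le_sum_charge (hne v hv) (touching_subset W v)
  have hmono : ∑ v ∈ L, ∑ w ∈ W, charge (touching W v) w ≤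
      ∑ v, ∑ w ∈ W, charge (touching W v) w :=
    Finset.sum_le_sum_of_subset (Finset.subset_univ L)
  omega

end LowerBound

/-! ### The upper bound -/

/-- The edges of `p` paths on three lines centred at rows, the `t`-th at row `t` with columns `2 t` and
`2 t + 1`, and of `q` paths centred at columns, the `t`-th at column `2 p + t` with rows `p + 2 t` and
`p + 2 t + 1`. -/
theorem exists_pathSet {m n p q : ℕ} (hm : p + 2 * q ≤ m) (hn : 2 * p + q ≤ n) :
    ∃ W : Finset ((Fin 1 ⊕ Fin m) × (Fin 1 ⊕ Fin n)), W.card ≤ 2 * p + 2 * q ∧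
      (∀ (i : Fin m) (j : Fin n), (j : ℕ) < 2 * p → (i : ℕ) = j / 2 → (.inr i, .inr j) ∈ W) ∧
      ∀ (i : Fin m) (j : Fin n), p ≤ (i : ℕ) → (i : ℕ) < p + 2 * q →
        (j : ℕ) = 2 * p + (i - p) / 2 → (.inr i, .inr j) ∈ W := by
  refine ⟨(Finset.univ.image fun t : Fin (2 * p) =>
      (.inr ⟨t / 2, by omega⟩, .inr ⟨t, by omega⟩)) ∪
    (Finset.univ.image fun t : Fin (2 * q) =>
      (.inr ⟨p + t, by omega⟩, .inr ⟨2 * p + t / 2, by omega⟩)), ?_, ?_, ?_⟩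
  · refine (Finset.card_union_le _ _).trans (add_le_add ?_ ?_) <;>
      exact Finset.card_image_le.trans (by simp)
  · intro i j hj hi
    refine Finset.mem_union_left _ (Finset.mem_image.mpr ⟨⟨j, hj⟩, Finset.mem_univ _, ?_⟩)
    ext1 <;> simp [Fin.ext_iff, hi]
  · intro i j hi hi' hj
    refine Finset.mem_union_right _
      (Finset.mem_image.mpr ⟨⟨i - p, by omega⟩, Finset.mem_univ _, ?_⟩)
    ext1 <;> simp [Fin.ext_iff, hj]
    omega

/-- Disjoint paths on three lines, together with a set `T` of loops at rows, resolve if they leave at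
most one line untouched and if no row `i` and column `j` are jointly touched exactly once by every
member. The last hypothesis rules this out: because of the path centred at row `0`, `i` would have to be
that row and `j` a column off the path. For `n ≤ 2` there is no such column, and a second path centred
at a row, or a loop at another row, has a member that touches neither. -/
theorem isResolvingSet_of_paths {m n p q : ℕ} {W : Finset ((Fin 1 ⊕ Fin m) × (Fin 1 ⊕ Fin n))}
    (hp : 0 < p) (hm : p + 2 * q ≤ m) (hn : 2 * p + q ≤ n)
    (hW₁ : ∀ (i : Fin m) (j : Fin n), (j : ℕ) < 2 * p → (i : ℕ) = j / 2 → (.inr i, .inr j) ∈ W)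
    (hW₂ : ∀ (i : Fin m) (j : Fin n), p ≤ (i : ℕ) → (i : ℕ) < p + 2 * q →
      (j : ℕ) = 2 * p + (i - p) / 2 → (.inr i, .inr j) ∈ W)
    (T : Finset (Fin m)) (hT : ∀ i ∈ T, p ≤ (i : ℕ) ∧ (.inr i, .inl 0) ∈ W)
    (hrest : ∀ i i' : Fin m, p + 2 * q ≤ (i : ℕ) → i ∉ T → p + 2 * q ≤ (i' : ℕ) → i' ∉ T → i = i')
    (hrest' : n ≤ 2 * p + q + 1)
    (hrest'' : n = 2 * p + q ∨ ∀ i : Fin m, p + 2 * q ≤ (i : ℕ) → i ∈ T)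
    (hextra : 2 ≤ p ∨ n ≤ 2 ∨ T.Nonempty) :
    ((star m).boxProd (star n)).IsResolvingSet W := by
  have touch_row : ∀ i : Fin m, ((i : ℕ) < p + 2 * q ∨ i ∈ T) → ∃ w ∈ W, w.1 = .inr i := by
    intro i hi
    by_cases hiT : i ∈ T
    · exact ⟨_, (hT i hiT).2, rfl⟩
    have hi : (i : ℕ) < p + 2 * q := by tauto
    by_cases hip : (i : ℕ) < p
    · exact ⟨_, hW₁ i ⟨2 * i, by omega⟩ (by simp; omega) (by simp), rfl⟩
    · exact ⟨_, hW₂ i ⟨2 * p + (i - p) / 2, by omega⟩ (by omega) hi rfl, rfl⟩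
  have touch_col : ∀ j : Fin n, (j : ℕ) < 2 * p + q → ∃ w ∈ W, w.2 = .inr j := by
    intro j hj
    by_cases hjp : (j : ℕ) < 2 * p
    · exact ⟨_, hW₁ ⟨j / 2, by omega⟩ j hjp rfl, rfl⟩
    · exact ⟨_, hW₂ ⟨p + 2 * (j - 2 * p), by omega⟩ j (by simp) (by simp; omega)
        (by simp; omega), rfl⟩
  refine isResolvingSet_of_touch (by omega) (by omega) ?_ ?_ ?_ ?_
  · intro i i' hne
    by_cases h : (i : ℕ) < p + 2 * q ∨ i ∈ T
    · obtain ⟨w, hw, e⟩ := touch_row i h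
      exact ⟨w, hw, .inl e⟩
    by_cases h' : (i' : ℕ) < p + 2 * q ∨ i' ∈ T
    · obtain ⟨w, hw, e⟩ := touch_row i' h'
      exact ⟨w, hw, .inr e⟩
    push Not at h h'
    exact (hne (hrest i i' h.1 h.2 h'.1 h'.2)).elim
  · intro j j' hne
    have hne' : (j : ℕ) ≠ j' := fun e => hne (Fin.ext e)
    by_cases h : (j : ℕ) < 2 * p + q
    · obtain ⟨w, hw, e⟩ := touch_col j h
      exact ⟨w, hw, .inl e⟩
    · obtain ⟨w, hw, e⟩ := touch_col j' (by omega)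
      exact ⟨w, hw, .inr e⟩
  · intro i j
    by_cases hiT : i ∈ T
    · exact ⟨_, (hT i hiT).2, by simp⟩
    by_cases hip : (i : ℕ) < p
    · -- Of the two edges at row `i`, one avoids column `j`.
      by_cases hj : (j : ℕ) = 2 * i
      · exact ⟨_, hW₁ i ⟨2 * i + 1, by omega⟩ (by simp; omega) (by simp; omega),
          by simp [Fin.ext_iff]; omega⟩
      · exact ⟨_, hW₁ i ⟨2 * i, by omega⟩ (by simp; omega) (by simp),
          by simp [Fin.ext_iff]; omega⟩
    by_cases hiq : (i : ℕ) < p + 2 * q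
    · by_cases hj : (j : ℕ) = 2 * p + (i - p) / 2
      · -- The other edge at column `j` avoids row `i`.
        by_cases hpar : (i - p : ℕ) % 2 = 0
        · exact ⟨_, hW₂ ⟨i + 1, by omega⟩ j (by simp; omega) (by simp; omega) (by simp; omega),
            by simp [Fin.ext_iff]⟩
        · exact ⟨_, hW₂ ⟨i - 1, by omega⟩ j (by simp; omega) (by simp; omega) (by simp; omega),
            by simp [Fin.ext_iff]; omega⟩
      · exact ⟨_, hW₂ i ⟨2 * p + (i - p) / 2, by omega⟩ (by omega) hiq rfl,
          by simp [Fin.ext_iff]; omega⟩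
    · -- Row `i` is touched by no path, so every column is touched, by an edge avoiding row `i`.
      have hcols : n = 2 * p + q := hrest''.resolve_right fun h => hiT (h i (by omega))
      by_cases hjp : (j : ℕ) < 2 * p
      · exact ⟨_, hW₁ ⟨j / 2, by omega⟩ j hjp rfl, by simp [Fin.ext_iff]; omega⟩
      · exact ⟨_, hW₂ ⟨p + 2 * (j - 2 * p), by omega⟩ j (by simp) (by simp; omega)
          (by simp; omega), by simp [Fin.ext_iff]; omega⟩
  · intro i j
    by_cases hi : (i : ℕ) = 0
    · by_cases hj : (j : ℕ) < 2
      · exact ⟨_, hW₁ i j (by omega) (by omega), by simp⟩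
      rcases hextra with hp2 | hn2 | ⟨i', hi'⟩
      · by_cases hj2 : (j : ℕ) = 2
        · exact ⟨_, hW₁ ⟨1, by omega⟩ ⟨3, by omega⟩ (by simp; omega) (by simp),
            by simp [Fin.ext_iff]; omega⟩
        · exact ⟨_, hW₁ ⟨1, by omega⟩ ⟨2, by omega⟩ (by simp; omega) (by simp),
            by simp [Fin.ext_iff]; omega⟩
      · omega
      · have := (hT i' hi').1
        exact ⟨_, (hT i' hi').2, by simp [Fin.ext_iff]; omega⟩
    · by_cases hj : (j : ℕ) = 0
      · exact ⟨_, hW₁ ⟨0, by omega⟩ ⟨1, by omega⟩ (by simp; omega) (by simp),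
          by simp [Fin.ext_iff]; omega⟩
      · exact ⟨_, hW₁ ⟨0, by omega⟩ ⟨0, by omega⟩ (by simp; omega) (by simp),
          by simp [Fin.ext_iff]; omega⟩

/-- In the exceptional case `m = n = 3`, one path and two loops. -/
theorem exists_isResolvingSet_three : ∃ W : Finset ((Fin 1 ⊕ Fin 3) × (Fin 1 ⊕ Fin 3)),
    ((star 3).boxProd (star 3)).IsResolvingSet W ∧ W.card ≤ 4 := by
  refine ⟨{(.inr 0, .inr 0), (.inr 0, .inr 1), (.inr 1, .inl 0), (.inl 0, .inr 2)}, ?_, by decide⟩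
  exact isResolvingSet_of_touch (by omega) (by omega) (by decide) (by decide) (by decide)
    (by decide)

theorem exists_isResolvingSet_card_le {m n : ℕ} (hn : 2 ≤ n) (hnm : n ≤ 2 * m) (hmn : m ≤ n) :
    ∃ W : Finset ((Fin 1 ⊕ Fin m) × (Fin 1 ⊕ Fin n)),
      ((star m).boxProd (star n)).IsResolvingSet W ∧ W.card ≤ 2 * (m + n) / 3 := by
  by_cases h3 : m = 3 ∧ n = 3
  · obtain ⟨rfl, rfl⟩ := h3
    exact exists_isResolvingSet_three
  have hmod : (m + n) % 3 = 0 ∨ (m + n) % 3 = 1 ∨ (m + n) % 3 = 2 := by omega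
  rcases hmod with h | h | h
  · -- The paths touch every line.
    obtain ⟨p, hp⟩ : ∃ p, 2 * n - m = 3 * p := ⟨(2 * n - m) / 3, by omega⟩
    obtain ⟨q, hq⟩ : ∃ q, 2 * m - n = 3 * q := ⟨(2 * m - n) / 3, by omega⟩
    obtain ⟨W, hc, h₁, h₂⟩ := exists_pathSet (m := m) (n := n) (p := p) (q := q) (by omega)
      (by omega)
    exact ⟨W, isResolvingSet_of_paths (by omega) (by omega) (by omega) h₁ h₂ ∅ (by simp)
      (fun i i' _ _ _ _ => by omega) (by omega) (.inl (by omega)) (by omega), by omega⟩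
  · -- The paths touch every line but the last row.
    obtain ⟨p, hp⟩ : ∃ p, 2 * n + 1 - m = 3 * p := ⟨(2 * n + 1 - m) / 3, by omega⟩
    obtain ⟨q, hq⟩ : ∃ q, 2 * m - n = 3 * q + 2 := ⟨(2 * m - n) / 3, by omega⟩
    obtain ⟨W, hc, h₁, h₂⟩ := exists_pathSet (m := m) (n := n) (p := p) (q := q) (by omega)
      (by omega)
    exact ⟨W, isResolvingSet_of_paths (by omega) (by omega) (by omega) h₁ h₂ ∅ (by simp)
      (fun i i' _ _ _ _ => by omega) (by omega) (.inl (by omega)) (by omega), by omega⟩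
  · -- The paths touch every line but the last row, which gets a loop, and the last column.
    obtain ⟨p, hp⟩ : ∃ p, 2 * n - m = 3 * p + 1 := ⟨(2 * n - m) / 3, by omega⟩
    obtain ⟨q, hq⟩ : ∃ q, 2 * m - n = 3 * q + 1 := ⟨(2 * m - n) / 3, by omega⟩
    obtain ⟨W, hc, h₁, h₂⟩ := exists_pathSet (m := m) (n := n) (p := p) (q := q) (by omega)
      (by omega)
    have hci := Finset.card_insert_le ((.inr ⟨m - 1, by omega⟩, .inl 0) :
      (Fin 1 ⊕ Fin m) × (Fin 1 ⊕ Fin n)) W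
    refine ⟨insert (.inr ⟨m - 1, by omega⟩, .inl 0) W,
      isResolvingSet_of_paths (p := p) (q := q) (by omega) (by omega) (by omega)
      (fun i j hj hi => Finset.mem_insert_of_mem (h₁ i j hj hi))
      (fun i j hi hi' hj => Finset.mem_insert_of_mem (h₂ i j hi hi' hj))
      {⟨m - 1, by omega⟩} ?_ ?_ (by omega) (.inr ?_) (.inr (.inr (by simp))), by omega⟩
    · intro i hi
      rw [Finset.mem_singleton.mp hi]
      exact ⟨by simp; omega, Finset.mem_insert_self _ _⟩
    · intro i i' _ _ _ _
      have := i.2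
      simp_all [Fin.ext_iff]
      omega
    · intro i hi
      have := i.2
      simp [Fin.ext_iff]
      omega

end SimpleGraph

theorem theorem3 (m n : ℕ) (hn : 2 ≤ n) (hnm : (n : ℚ) / 2 ≤ (m : ℚ)) (hmn : m ≤ n) :
    (((SimpleGraph.star m).boxProd (SimpleGraph.star n)).metricDim : ℤ) =
      (n : ℤ) + ⌊(2 * (m : ℚ) - (n : ℚ)) / 3⌋ := by
  have hnm' : n ≤ 2 * m := by
    have : (n : ℚ) ≤ 2 * m := by linarith
    exact_mod_cast this
  have hfloor : ⌊(2 * (m : ℚ) - (n : ℚ)) / 3⌋ = (2 * (m : ℤ) - n) / 3 := by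
    have := Rat.floor_intCast_div_natCast (2 * (m : ℤ) - n) 3
    push_cast at this
    exact this
  obtain ⟨⟨V, hV, hVcard⟩, hleast⟩ :=
    ((SimpleGraph.star m).boxProd (SimpleGraph.star n)).isLeast_metricDim
  have hlower := hV.two_mul_le_three_mul_card
  obtain ⟨W, hW, hWcard⟩ := SimpleGraph.exists_isResolvingSet_card_le hn hnm' hmn
  have hupper := hleast ⟨W, hW, rfl⟩
  rw [hfloor]
  omega
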